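/- **Model.** Fix constants $\lambda,\nu,q,\tau>0$, $\bar V\in\mathbb N$, $\bar w\ge 0$, integers $1\le F\le h$ and $k\ge 2$. A network has a finite space of at most $\bar V$ network IDs, a set $\mathcal V(t)$ of nodes that may grow with time $t\ge 0$, undirected peer connections forming a connected graph on $\mathcal V(t)$ at every time, and one additional agent node $a$. All these objects may be random. * *Peering.* Every node has at most $h$ peer connections, and among these at least $F$ dynamic slots. The agent has at most $k$ peers, all of its own choosing, and can request a connection to a node only after learning its network ID. It repeats its requests at arbitrarily high frequency and slots are filled first come, first served: as long as the agent requests $v$ without being its peer, all dynamic slots of $v$ are occupied by connections to other nodes, established no later than the time of the request. Thus the agent gets the first slot that becomes free, and regains it at once if the connection is torn down. A connection to the agent otherwise ends only when the agent withdraws its request. * *Messages.* Each link has a constant latency $w(x,y)\in(0,\bar w]$ for $x\ne y$ (agent included), satisfying the triangle inequality $w(x,y)\le w(x,z)+w(z,y)$. Messages are flooded: a node forwards a message at the moment of its first receipt to its current peers, and a copy sent from $x$ to $y$ takes time $w(x,y)$. The agent does not relay. For each received message, the agent observes the logical ID of its sender, the arrival time and the peer that delivered it first (a copy coming directly from the sender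 counts as first if it arrives simultaneously with relayed copies). A logical ID $u$ belongs to a node $\mathrm{NID}(u)$; the map $\mathrm{NID}$ is unknown to the agent. * *Oracle.* A query takes time $\tau$, and the agent has at most one pending query at a time. The answer is the network ID of an existing node; conditionally on the earlier answers, each node of the network is drawn with probability at least $q$. * *Liveness.* The network is $(\lambda,\nu)$-live with respect to a set $U$ of targets: (I) dynamic connections have duration $\mathrm{Exp}(\lambda)$ (unless ended earlier by the agent), independent of the time at which they are established and of whether they are established by the agent; (II) for each $u\in U$, the messages of $u$ form a Poisson process of rate $\nu$. **Peri-like strategy.** Time is divided into rounds of fixed length, and a fixed number of consecutive rounds is devoted to each target in turn. In each round, the agent draws $k-1$ network IDs from the oracle, and after an initial waiting time it listens for the first new message of the current target. At the end of the round it keeps only the peer that delivered this message first (or the previously kept one if there was no such message) and requests connections to the $k-1$ drawn nodes in place of the other peers. The peer kept at the end of the rounds of a target is announced as its network ID. Finally, the agent requests connections to all announced nodes if there are at most $k$ of them. **Theorem.** For every $\varepsilon_0<1$ there is a constant $C$, depending only on $\varepsilon_0$ and the constants of the model, such that for every $r\ge1$ and every $\varepsilon\in(0,\varepsilon_0]$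 the round length, the waiting time and the number of rounds of the Peri-like strategy can be chosen such that it ends at a time $$T\le C\,r^2\,\varepsilon^{-1}\log^2(\varepsilon^{-1})$$ and the following holds. In every $(\lambda,\nu)$-live network as above with a set $U$ of $|U|=r$ target logical IDs that belong to distinct nodes present from time $0$ on, if the agent follows this strategy, then with probability at least $1-\varepsilon$ the agent announces by time $T$ the correct network ID $\mathrm{NID}(u)$ of every target $u\in U$ and, provided that $|U|\le k$, is at time $T$ a peer of all the targets. -/

import Mathlib

open MeasureTheory ProbabilityTheory
open scoped NNReal ENNReal

noncomputable section

/-- The numerical constants of the model. -/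
structure NetParams where
  /-- dynamic connections last an `Exp(lam)` time -/
  lam : ℝ
  /-- every target broadcasts according to a Poisson process of rate `nu` -/
  nu : ℝ≥0
  /-- lower bound for the probability that the oracle draws a given node of the network -/
  q : ℝ≥0
  /-- time that the oracle needs to process one query -/
  tau : ℝ≥0
  /-- upper bound for the number of network IDs -/
  maxNodes : ℕ
  /-- upper bound for the link latencies -/
  maxLatency : ℝ≥0
  /-- upper bound for the number of peer connections of a node -/
  h : ℕ
  /-- lower bound for the number of dynamic peer slots of a node -/
  F : ℕ
  /-- upper bound for the number of peer connections of the agent -/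
  k : ℕ
  lam_pos : 0 < lam
  nu_pos : 0 < nu
  q_pos : 0 < q
  tau_pos : 0 < tau
  F_pos : 0 < F
  F_le : F ≤ h
  two_le_k : 2 ≤ k

/-- The objects that make up a time-varying network together with one agent node, on the
sample space `Ω`. `V` is the space of network IDs of the nodes other than the agent, `L` is the
space of logical IDs, and time is `ℝ≥0`. In `Option V`, the value `none` stands for the agent.

The dynamic slots of a node `v` are numbered by `Fin (slots v)`, and the successive connections
occupying the slot `i` of `v` are numbered by `ℕ` (a connection that never comes about has
starting time `∞`). -/
structure NetworkData (V L Ω : Type*) where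
  /-- the (unknown) map from logical IDs to network IDs -/
  NID : L → V
  /-- link latency -/
  w : Option V → Option V → ℝ≥0
  /-- the nodes present at a given time -/
  nodes : ℝ≥0 → Ω → Set V
  /-- the peer connections between nodes other than the agent -/
  graph : ℝ≥0 → Ω → SimpleGraph V
  /-- the number of dynamic slots of a node -/
  slots : V → ℕ
  /-- the time at which the `n`-th connection in a dynamic slot is established -/
  start : (v : V) → Fin (slots v) → ℕ → Ω → ℝ≥0∞
  /-- the random duration of that connection -/
  lifetime : (v : V) → Fin (slots v) → ℕ → Ω → ℝ
  /-- the time at which that connection ends -/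
  finish : (v : V) → Fin (slots v) → ℕ → Ω → ℝ≥0∞
  /-- the peer at the other end of that connection (`none` is the agent) -/
  occupant : (v : V) → Fin (slots v) → ℕ → Ω → Option V
  /-- the nodes with which the agent requests (repeatedly) to be connected at a given time -/
  requests : ℝ≥0 → Ω → Finset V
  /-- the number of messages signed by a logical ID that were broadcast up to a given time -/
  M : L → ℝ≥0 → Ω → ℕ
  /-- the time at which a node receives the `m`-th message of a logical ID for the first time -/
  reception : L → ℕ → Ω → V → ℝ≥0∞
  /-- the peer that is the first to deliver the `m`-th message of a logical ID to the agent -/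
  firstPeer : L → ℕ → Ω → Option V
  /-- the answer of the oracle to the query that is submitted at a given time -/
  oracle : ℝ≥0 → Ω → V

namespace NetworkData

variable {V L Ω : Type*} (N : NetworkData V L Ω)

/-- The `n`-th connection in the slot `i` of `v` exists at time `t`. -/
def Alive (v : V) (i : Fin (N.slots v)) (n : ℕ) (t : ℝ≥0) (ω : Ω) : Prop :=
  N.start v i n ω ≤ t ∧ (t : ℝ≥0∞) < N.finish v i n ω

/-- The nodes that are peers of the agent at time `t`. -/
def peers (t : ℝ≥0) (ω : Ω) : Set V :=
  {v | ∃ i n, N.Alive v i n t ω ∧ N.occupant v i n ω = none}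

/-- The time at which the `m`-th message (`m = 0, 1, …`) of the logical ID `u` is broadcast. -/
def broadcastTime (u : L) (m : ℕ) (ω : Ω) : ℝ≥0∞ :=
  ⨅ (t : ℝ≥0) (_ : m < N.M u t ω), (t : ℝ≥0∞)

/-- The time at which the peer `v` delivers the `m`-th message of `u` to the agent: `v` forwards
the message when it receives it, provided that the agent is its peer at that moment. -/
def deliveryTime (u : L) (m : ℕ) (ω : Ω) (v : V) : ℝ≥0∞ :=
  ⨅ (t : ℝ≥0) (_ : N.reception u m ω v = t ∧ v ∈ N.peers t ω),
    ((t + N.w (some v) none : ℝ≥0) : ℝ≥0∞)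

/-- The time at which the agent receives the `m`-th message of `u` for the first time. -/
def firstArrival (u : L) (m : ℕ) (ω : Ω) : ℝ≥0∞ :=
  ⨅ v, N.deliveryTime u m ω v

end NetworkData

/-- The laws that the network obeys on every sample path. -/
structure IsP2PNetwork (P : NetParams) {V L Ω : Type*} [Fintype V] (N : NetworkData V L Ω) :
    Prop where
  card_le : Fintype.card V ≤ P.maxNodes
  w_pos : ∀ x y, x ≠ y → 0 < N.w x y
  w_le : ∀ x y, N.w x y ≤ P.maxLatency
  triangle : ∀ x y z, N.w x y ≤ N.w x z + N.w z y
  -- nodes may be spawned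
  nodes_mono : ∀ s t ω, s ≤ t → N.nodes s ω ⊆ N.nodes t ω
  graph_nodes : ∀ t ω u v, (N.graph t ω).Adj u v → u ∈ N.nodes t ω
  connected : ∀ t ω, ((N.graph t ω).induce (N.nodes t ω)).Connected
  degree_le : ∀ t ω v,
    ((N.graph t ω).neighborSet v).ncard + (N.peers t ω ∩ {v}).ncard ≤ P.h
  le_slots : ∀ v, P.F ≤ N.slots v
  slots_le : ∀ v, N.slots v ≤ P.h
  start_le_finish : ∀ v i n ω, N.start v i n ω ≤ N.finish v i n ω
  finish_le_start : ∀ v i n ω, N.finish v i n ω ≤ N.start v i (n + 1) ω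
  -- a dynamic connection between two nodes other than the agent is an edge, and it lasts for
  -- its lifetime
  adj_of_alive : ∀ v i n t ω u, N.Alive v i n t ω → N.occupant v i n ω = some u →
    (N.graph t ω).Adj v u
  finish_eq : ∀ v i n ω u, N.occupant v i n ω = some u →
    N.finish v i n ω = N.start v i n ω + ENNReal.ofReal (N.lifetime v i n ω)
  -- a connection to the agent exists only at the agent's request; it ends with its lifetime, or
  -- earlier if the agent withdraws the request
  agent_alive : ∀ v t ω, v ∈ N.peers t ω → v ∈ N.requests t ω ∧ v ∈ N.nodes t ω
  agent_finish_le : ∀ v i n ω, N.occupant v i n ω = none →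
    N.finish v i n ω ≤ N.start v i n ω + ENNReal.ofReal (N.lifetime v i n ω)
  agent_finish : ∀ v i n ω, N.occupant v i n ω = none →
    N.finish v i n ω < N.start v i n ω + ENNReal.ofReal (N.lifetime v i n ω) →
    ∃ t : ℝ≥0, N.finish v i n ω = t ∧ v ∉ N.requests t ω
  -- slots are given first come, first served, and the agent repeats its requests at arbitrarily
  -- high frequency: if the agent has been requesting `v` since time `s` and is not a peer of `v`
  -- at time `t`, then every dynamic slot of `v` is full, and since time `s` none of them has
  -- become free
  fcfs : ∀ v s t ω, s ≤ t → v ∈ N.nodes s ω → (∀ r ∈ Set.Icc s t, v ∈ N.requests r ω) →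
    v ∉ N.peers t ω →
    ∀ i, ∃ n, N.start v i n ω ≤ s ∧ (t : ℝ≥0∞) < N.finish v i n ω ∧ N.occupant v i n ω ≠ none
  -- the messages of each logical ID form a counting process
  M_zero : ∀ u ω, N.M u 0 ω = 0
  M_mono : ∀ u ω, Monotone fun t => N.M u t ω
  M_rightCont : ∀ u ω t, ContinuousWithinAt (fun t => N.M u t ω) (Set.Ici t) t
  -- flooding: a message starts at its sender, and each node forwards it to its neighbours at
  -- the moment of the first receipt
  reception_source : ∀ u m ω, N.reception u m ω (N.NID u) = N.broadcastTime u m ω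
  reception_flood : ∀ u m ω v, v ≠ N.NID u → N.reception u m ω v =
    ⨅ (p : V) (t : ℝ≥0) (_ : N.reception u m ω p = t ∧ (N.graph t ω).Adj p v),
      ((t + N.w (some p) (some v) : ℝ≥0) : ℝ≥0∞)
  -- the first delivery to the agent; when the copy that comes directly from the sender arrives
  -- simultaneously with relayed copies, it counts as the first one
  firstPeer_spec : ∀ u m ω v, N.firstPeer u m ω = some v →
    N.deliveryTime u m ω v = N.firstArrival u m ω
  firstPeer_isSome : ∀ u m ω, N.firstArrival u m ω ≠ ⊤ → N.firstPeer u m ω ≠ none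
  firstPeer_direct : ∀ u m ω, N.firstArrival u m ω ≠ ⊤ →
    N.deliveryTime u m ω (N.NID u) = N.firstArrival u m ω →
    N.firstPeer u m ω = some (N.NID u)
  oracle_mem : ∀ s ω, N.oracle s ω ∈ N.nodes s ω

/-- A Poisson process of rate `nu` on the time axis `ℝ≥0`. -/
structure IsPoissonProcess {Ω : Type*} [MeasurableSpace Ω] (nu : ℝ≥0) (M : ℝ≥0 → Ω → ℕ)
    (μ : Measure Ω) : Prop where
  measurable : ∀ t, Measurable (M t)
  zero : ∀ ω, M 0 ω = 0
  mono : ∀ ω, Monotone fun t => M t ω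
  rightCont : ∀ ω t, ContinuousWithinAt (fun t => M t ω) (Set.Ici t) t
  indep : HasIndepIncrements M μ
  law : ∀ s t, s ≤ t → HasLaw (fun ω => M t ω - M s ω) (poissonMeasure (nu * (t - s))) μ

/-- The information contained in the answers of the oracle that were given up to time `s`. -/
@[reducible] def NetworkData.oracleHistory {V L Ω : Type*} (P : NetParams) (N : NetworkData V L Ω)
    (s : ℝ≥0) : MeasurableSpace Ω :=
  ⨆ (r : ℝ≥0) (_ : r + P.tau ≤ s), MeasurableSpace.comap (N.oracle r) ⊤

/-- Whatever the oracle answered before, it draws each node of the network with probability at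
least `q`. -/
structure HasOracleLaw (P : NetParams) {V L Ω : Type*} [MeasurableSpace Ω]
    (N : NetworkData V L Ω) (μ : Measure Ω) : Prop where
  measurable : ∀ s v, MeasurableSet {ω | N.oracle s ω = v}
  le_draw : ∀ s v A, MeasurableSet[N.oracleHistory P s] A →
    (P.q : ℝ≥0∞) * μ (A ∩ {ω | v ∈ N.nodes s ω}) ≤ μ (A ∩ {ω | N.oracle s ω = v})

/-- A `(lam, nu)`-live network with target set `T`: the dynamic connections have durations
`Exp(lam)`, independent of the time at which they are established and of whether they are
established by the agent, and the messages of each target form a Poisson process of rate `nu`. -/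
structure IsLive {V L Ω : Type*} [MeasurableSpace Ω] (lam : ℝ) (nu : ℝ≥0)
    (N : NetworkData V L Ω) (T : Set L) (μ : Measure Ω) : Prop where
  measurable_start : ∀ v i n, Measurable (N.start v i n)
  measurable_occupant : ∀ v i n, Measurable fun ω => (N.occupant v i n ω).isNone
  lifetime_law : ∀ v i n, HasLaw (N.lifetime v i n) (expMeasure lam) μ
  lifetime_indep : ∀ v i n,
    IndepFun (N.lifetime v i n) (fun ω => (N.start v i n ω, (N.occupant v i n ω).isNone)) μ
  poisson : ∀ u ∈ T, IsPoissonProcess nu (N.M u) μ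

/-- What the agent gets to see: for each message, identified by the logical ID of its sender and
a serial number, the time of its first arrival and the peer that delivered it first; and the
answers of the oracle. -/
structure AgentView (V L : Type*) where
  arrival : L → ℕ → ℝ≥0∞
  firstPeer : L → ℕ → Option V
  answer : ℝ≥0 → V

/-- The agent's view along a sample path. -/
def NetworkData.view {V L Ω : Type*} (N : NetworkData V L Ω) (ω : Ω) : AgentView V L where
  arrival u m := N.firstArrival u m ω
  firstPeer u m := N.firstPeer u m ω
  answer s := N.oracle s ω

/-- Two views cannot be told apart at time `t` by an agent that submits queries at the times in
`Q`, each of which is answered after `tau`. -/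
def AgentView.AgreeUpTo {V L : Type*} (tau : ℝ≥0) (Q : Set ℝ≥0) (t : ℝ≥0)
    (x y : AgentView V L) : Prop :=
  (∀ u m, x.arrival u m ≤ t ∨ y.arrival u m ≤ t →
    x.arrival u m = y.arrival u m ∧ x.firstPeer u m = y.firstPeer u m) ∧
  ∀ s ∈ Q, s + tau ≤ t → x.answer s = y.answer s

/-- A strategy of an agent for finding `r` targets: it acts on its observations only, it
respects its peer budget, and it submits the next query only after the previous one has been
answered. -/
structure Strategy (P : NetParams) (V L : Type*) (r : ℕ) where
  queries : Set ℝ≥0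
  requests : AgentView V L → ℝ≥0 → Finset V
  /-- the time at which the strategy announces its findings -/
  horizon : ℝ≥0
  /-- the network IDs that it announces for the targets -/
  output : AgentView V L → Fin r → Option V
  queries_spaced : ∀ s ∈ queries, ∀ t ∈ queries, s < t → s + P.tau ≤ t
  budget : ∀ x t, (requests x t).card ≤ P.k
  requests_causal : ∀ x y t, x.AgreeUpTo P.tau queries t y → requests x t = requests y t
  output_causal : ∀ x y, x.AgreeUpTo P.tau queries horizon y → output x = output y

/-- The agent of the network `N` follows the strategy `σ`. -/
def Strategy.Follows {P : NetParams} {V L Ω : Type*} {r : ℕ} (σ : Strategy P V L r)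
    (N : NetworkData V L Ω) : Prop :=
  ∀ t ω, N.requests t ω = σ.requests (N.view ω) t

/-- The timing of the Peri-like strategy. Time is divided into rounds of length `len`, and
`rounds` consecutive rounds are devoted to each target. In each round the agent
ignores the messages that arrive before `warm` has elapsed. -/
structure PeriSchedule (P : NetParams) where
  rounds : ℕ
  len : ℝ≥0
  warm : ℝ≥0
  len_pos : 0 < len
  /-- there is enough time for `k - 1` queries in each round -/
  queries_le : ((P.k - 1 : ℕ) : ℝ≥0) * P.tau ≤ len

namespace Peri

variable {P : NetParams} {V L : Type*}

/-- The `m`-th message of `u` is the first among the messages of `u` that arrive in `[a, b)`. -/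
def FirstIn (x : AgentView V L) (u : L) (a b : ℝ≥0) (m : ℕ) : Prop :=
  x.arrival u m ∈ Set.Ico (a : ℝ≥0∞) b ∧
    ∀ m', x.arrival u m' ∈ Set.Ico (a : ℝ≥0∞) b → x.arrival u m ≤ x.arrival u m'

open Classical in
/-- The peer that delivered the first message of `u` arriving in `[a, b)`, if there is one. -/
def heard (x : AgentView V L) (u : L) (a b : ℝ≥0) : Option V :=
  if h : ∃ m, FirstIn x u a b m then x.firstPeer u h.choose else none

/-- The peer that is kept at the beginning of round `n`: in each round, keep the peer that
delivered the first new message of the current target (and the old one if there was none). -/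
def kept (S : PeriSchedule P) {r : ℕ} (tgt : Fin r → L) (x : AgentView V L) : ℕ → Option V
  | 0 => none
  | n + 1 =>
    if h : n / S.rounds < r then
      (heard x (tgt ⟨n / S.rounds, h⟩) (n * S.len + S.warm) ((n + 1) * S.len)).or
        (kept S tgt x n)
    else kept S tgt x n

open Classical in
/-- The `k - 1` addresses obtained from the oracle during round `n`. -/
def fresh (S : PeriSchedule P) (x : AgentView V L) (n : ℕ) : Finset V :=
  (Finset.range (P.k - 1)).image fun j : ℕ => x.answer (n * S.len + j * P.tau)

/-- The network ID announced for the target `i`: the peer that is kept at the end of the rounds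
devoted to it. -/
def found (S : PeriSchedule P) {r : ℕ} (tgt : Fin r → L) (x : AgentView V L) (i : Fin r) :
    Option V :=
  kept S tgt x ((i + 1) * S.rounds)

open Classical in
/-- The set of all network IDs that were announced, if it fits into the peer budget. -/
def finalRequests (S : PeriSchedule P) {r : ℕ} (tgt : Fin r → L) (x : AgentView V L) :
    Finset V :=
  if (Finset.univ.biUnion fun i => (found S tgt x i).toFinset).card ≤ P.k then
    Finset.univ.biUnion fun i => (found S tgt x i).toFinset
  else ∅

open Classical in
/-- The requests in round `n`: in round `0` the agent knows no address; in each of the following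
rounds, it requests the kept peer and the addresses obtained in the previous round; in the end
it requests all the nodes that it has found. -/
def roundRequests (S : PeriSchedule P) {r : ℕ} (tgt : Fin r → L) (x : AgentView V L) (n : ℕ) :
    Finset V :=
  if r * S.rounds ≤ n then finalRequests S tgt x
  else if n = 0 then ∅
  else (kept S tgt x n).toFinset ∪ fresh S x (n - 1)

/-- The times at which the oracle is queried: `k - 1` times in each round. -/
def queryTimes (S : PeriSchedule P) : Set ℝ≥0 :=
  {s | ∃ n j : ℕ, j < P.k - 1 ∧ s = n * S.len + j * P.tau}

theorem query_end_le (S : PeriSchedule P) (n j : ℕ) (hj : j < P.k - 1) :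
    n * S.len + j * P.tau + P.tau ≤ (n + 1) * S.len := by
  have h1 : ((j + 1 : ℕ) : ℝ≥0) * P.tau ≤ ((P.k - 1 : ℕ) : ℝ≥0) * P.tau := by
    gcongr
    exact hj
  have h2 := h1.trans S.queries_le
  push_cast at h2
  calc (n : ℝ≥0) * S.len + j * P.tau + P.tau = n * S.len + (j + 1) * P.tau := by ring
    _ ≤ n * S.len + S.len := by gcongr
    _ = (n + 1) * S.len := by ring

theorem heard_congr {Q : Set ℝ≥0} {tau t : ℝ≥0} {x y : AgentView V L}
    (hxy : x.AgreeUpTo tau Q t y) (u : L) (a b : ℝ≥0) (hb : b ≤ t) :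
    heard x u a b = heard y u a b := by
  have hbt : (b : ℝ≥0∞) ≤ t := by exact_mod_cast hb
  have key : ∀ m, x.arrival u m ∈ Set.Ico (a : ℝ≥0∞) b ∨
      y.arrival u m ∈ Set.Ico (a : ℝ≥0∞) b →
      x.arrival u m = y.arrival u m ∧ x.firstPeer u m = y.firstPeer u m := by
    rintro m (h | h)
    · exact hxy.1 u m (Or.inl (h.2.le.trans hbt))
    · exact hxy.1 u m (Or.inr (h.2.le.trans hbt))
  have hF : FirstIn x u a b = FirstIn y u a b := by
    funext m
    refine propext ⟨fun h => ?_, fun h => ?_⟩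
    · have e := (key m (Or.inl h.1)).1
      refine ⟨e ▸ h.1, fun m' hm' => ?_⟩
      have e' := (key m' (Or.inr hm')).1
      rw [← e, ← e']
      exact h.2 m' (e' ▸ hm')
    · have e := (key m (Or.inr h.1)).1
      refine ⟨e ▸ h.1, fun m' hm' => ?_⟩
      have e' := (key m' (Or.inl hm')).1
      rw [e, e']
      exact h.2 m' (e' ▸ hm')
  unfold heard
  by_cases h : ∃ m, FirstIn x u a b m
  · have h' : ∃ m, FirstIn y u a b m := hF ▸ h
    have hc : h.choose = h'.choose := by
      congr 1
    rw [dif_pos h, dif_pos h', ← hc]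
    exact (key _ (Or.inl h.choose_spec.1)).2
  · have h' : ¬ ∃ m, FirstIn y u a b m := hF ▸ h
    rw [dif_neg h, dif_neg h']

theorem kept_congr (S : PeriSchedule P) {r : ℕ} (tgt : Fin r → L) {Q : Set ℝ≥0} {tau t : ℝ≥0}
    {x y : AgentView V L} (hxy : x.AgreeUpTo tau Q t y) (n : ℕ) (hn : n * S.len ≤ t) :
    kept S tgt x n = kept S tgt y n := by
  induction n with
  | zero => rfl
  | succ n ih =>
    push_cast at hn
    have hn' : n * S.len ≤ t := le_trans (by gcongr; simp) hn
    simp only [kept, ih hn', heard_congr hxy _ _ _ hn]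

theorem fresh_congr (S : PeriSchedule P) {t : ℝ≥0}
    {x y : AgentView V L} (hxy : x.AgreeUpTo P.tau (queryTimes S) t y) (n : ℕ)
    (hn : (n + 1) * S.len ≤ t) : fresh S x n = fresh S y n := by
  classical
  unfold fresh
  refine Finset.image_congr fun j hj => ?_
  have hj' : j < P.k - 1 := by simpa using hj
  exact hxy.2 _ ⟨n, j, hj', rfl⟩ ((query_end_le S n j hj').trans hn)

theorem found_congr (S : PeriSchedule P) {r : ℕ} (tgt : Fin r → L) {Q : Set ℝ≥0}
    {tau t : ℝ≥0} {x y : AgentView V L} (hxy : x.AgreeUpTo tau Q t y)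
    (ht : ((r * S.rounds : ℕ) : ℝ≥0) * S.len ≤ t) (i : Fin r) :
    found S tgt x i = found S tgt y i := by
  refine kept_congr S tgt hxy _ (le_trans ?_ ht)
  gcongr
  exact i.2

theorem card_finalRequests (S : PeriSchedule P) {r : ℕ} (tgt : Fin r → L)
    (x : AgentView V L) : (finalRequests S tgt x).card ≤ P.k := by
  classical
  unfold finalRequests
  split_ifs with h
  · exact h
  · simp

theorem card_roundRequests (S : PeriSchedule P) {r : ℕ} (tgt : Fin r → L)
    (x : AgentView V L) (n : ℕ) : (roundRequests S tgt x n).card ≤ P.k := by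
  classical
  unfold roundRequests
  split_ifs
  · exact card_finalRequests S tgt x
  · simp
  · have h1 : (kept S tgt x n).toFinset.card ≤ 1 := by
      cases kept S tgt x n <;> simp
    have h2 : (fresh S x (n - 1)).card ≤ P.k - 1 :=
      Finset.card_image_le.trans (by simp)
    have h3 := P.two_le_k
    exact (Finset.card_union_le _ _).trans (by omega)

theorem roundRequests_congr (S : PeriSchedule P) {r : ℕ} (tgt : Fin r → L) {t : ℝ≥0}
    {x y : AgentView V L} (hxy : x.AgreeUpTo P.tau (queryTimes S) t y) (n : ℕ)
    (hn : n * S.len ≤ t) : roundRequests S tgt x n = roundRequests S tgt y n := by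
  unfold roundRequests
  split_ifs with h1 h2
  · have hf : found S tgt x = found S tgt y := by
      funext i
      refine found_congr S tgt hxy (le_trans ?_ hn) i
      gcongr
    simp only [finalRequests, hf]
  · rfl
  · have e : ((n - 1 : ℕ) : ℝ≥0) + 1 = n := by
      have : n - 1 + 1 = n := by omega
      exact_mod_cast this
    rw [kept_congr S tgt hxy n hn, fresh_congr S hxy (n - 1) (by rw [e]; exact hn)]

end Peri

/-- The Peri-like strategy: for one target after the other, in each round keep the peer that was
the first to deliver a new message of the target and replace the other peers by nodes drawn from
the oracle; finally, connect to the nodes that were found. -/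
def peri {P : NetParams} (S : PeriSchedule P) (V : Type*) {L : Type*} {r : ℕ}
    (tgt : Fin r → L) : Strategy P V L r where
  queries := Peri.queryTimes S
  requests x t := Peri.roundRequests S tgt x ⌊t / S.len⌋₊
  horizon := (r * S.rounds + 1) * S.len
  output x := Peri.found S tgt x
  queries_spaced := by
    rintro s ⟨n, j, hj, rfl⟩ t ⟨n', j', hj', rfl⟩ hst
    rcases lt_trichotomy n n' with h | h | h
    · refine (Peri.query_end_le S n j hj).trans (le_trans ?_ le_self_add)
      gcongr
      exact_mod_cast h
    · subst h
      have h1 : (j : ℝ≥0) * P.tau < j' * P.tau := lt_of_add_lt_add_left hst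
      have h2 : j < j' := by exact_mod_cast lt_of_mul_lt_mul_right h1 (by simp)
      have h3 : ((j + 1 : ℕ) : ℝ≥0) * P.tau ≤ j' * P.tau := by
        gcongr
        exact h2
      calc (n : ℝ≥0) * S.len + j * P.tau + P.tau
          = n * S.len + ((j + 1 : ℕ) : ℝ≥0) * P.tau := by push_cast; ring
        _ ≤ _ := by gcongr
    · exfalso
      have h1 := Peri.query_end_le S n' j' hj'
      have h2 : ((n' : ℝ≥0) + 1) * S.len ≤ n * S.len := by
        gcongr
        exact_mod_cast h
      have h3 : (n' : ℝ≥0) * S.len + j' * P.tau ≤ n * S.len + j * P.tau :=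
        (le_self_add.trans h1).trans (h2.trans le_self_add)
      exact absurd hst (not_lt.2 h3)
  budget x t := Peri.card_roundRequests S tgt x _
  requests_causal x y t hxy := by
    refine Peri.roundRequests_congr S tgt hxy _ ?_
    have h : (⌊t / S.len⌋₊ : ℝ≥0) ≤ t / S.len := Nat.floor_le (by simp)
    calc (⌊t / S.len⌋₊ : ℝ≥0) * S.len ≤ t / S.len * S.len := by gcongr
      _ = t := div_mul_cancel₀ t S.len_pos.ne'
  output_causal x y hxy := by
    funext i
    refine Peri.found_congr S tgt hxy ?_ i
    push_cast
    gcongr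
    exact le_self_add

/-- The strategy `σ` fails on the sample path `ω`: at its horizon, some target is announced
wrongly, or the budget allows for being connected to all of the targets but some target is not
a peer of the agent. -/
def Strategy.FailsAt {P : NetParams} {V L Ω : Type*} {r : ℕ} (σ : Strategy P V L r)
    (N : NetworkData V L Ω) (tgt : Fin r → L) (ω : Ω) : Prop :=
  ¬ ((∀ i, σ.output (N.view ω) i = some (N.NID (tgt i))) ∧
    (r ≤ P.k → ∀ i, N.NID (tgt i) ∈ N.peers σ.horizon ω))

end

/-! By the triangle inequality and the tie-breaking rule, a message broadcast while the agent is a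
peer of the sender is delivered first by the sender (`direct_delivery`). So once the target is drawn
and connected, it wins every comparison, and once kept it stays kept. The waiting time `x + maxNodes
* maxLatency` serves two purposes: within time `x` a slot of the requested node becomes free, and
any message arriving after the rest of it was broadcast when the connection already existed
(`firstPeer_eq`). On each sample path (`found_eq`, `not_failsAt`) only three things can go wrong:
the oracle misses a target in all of its rounds but the last, a target is silent for time `x` in
some round, or a slot of a target is blocked for longer than `x`.

Each has exponentially small probability. The delicate one is blocking, since the number of earlier
connections in a slot is random and different connections need not be independent: the expected
number of connections started by time `s` is at most `exp lam` times the expected number of those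
lasting longer than `1`, of which disjointness allows at most `s + 1` (`measure_longConnection_le`).
A union bound (`measure_failsAt_le`) reduces the theorem to real analysis: with `X = r / ε`, it
suffices that the number of rounds and the round length be of order `1 + log X`
(`exists_rounds_and_length`). -/

namespace NetworkData

variable {V L Ω : Type*}

/-! ### Sample-path facts: flooding, direct delivery, slot occupancy. -/

/-- The nodes that receive a message strictly before a given node. -/
def earlier (N : NetworkData V L Ω) (u : L) (m : ℕ) (ω : Ω) (v : V) : Set V :=
  {p | N.reception u m ω p < N.reception u m ω v}

/-- The slot `i` of `v` is occupied by a connection to another node that was established by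
time `s` and lasts longer than `x`. -/
def longConnection (N : NetworkData V L Ω) (v : V) (i : Fin (N.slots v)) (s x : ℝ≥0) : Set Ω :=
  {ω | ∃ n, (N.start v i n ω ≤ s ∧ (N.occupant v i n ω).isNone = false) ∧
    (x : ℝ) < N.lifetime v i n ω}

theorem reception_add_le_deliveryTime (N : NetworkData V L Ω) (u : L) (m : ℕ) (ω : Ω) (v : V) :
    N.reception u m ω v + N.w (some v) none ≤ N.deliveryTime u m ω v := by
  refine le_iInf₂ fun t ht => ?_
  rw [ht.1, ENNReal.coe_add]

end NetworkData

namespace IsP2PNetwork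

variable {P : NetParams} {V L Ω : Type*} [Fintype V] {N : NetworkData V L Ω}

/-- The first copy of a message that reaches a node other than the sender comes from a peer. -/
theorem exists_relay (hN : IsP2PNetwork P N) {u : L} {m : ℕ} {ω : Ω} {v : V}
    (hv : v ≠ N.NID u) (hfin : N.reception u m ω v ≠ ⊤) :
    ∃ (p : V) (t : ℝ≥0), N.reception u m ω p = t ∧ p ≠ v ∧
      N.reception u m ω v = ((t + N.w (some p) (some v) : ℝ≥0) : ℝ≥0∞) := by
  have : Nonempty V := ⟨v⟩
  have h := hN.reception_flood u m ω v hv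
  -- As `V` is finite, some relay attains the infimum; for this relay, the inner infimum runs over
  -- at most one time.
  obtain ⟨p, hp⟩ := exists_eq_ciInf_of_finite (f := fun p : V =>
    ⨅ (t : ℝ≥0) (_ : N.reception u m ω p = t ∧ (N.graph t ω).Adj p v),
      ((t + N.w (some p) (some v) : ℝ≥0) : ℝ≥0∞))
  rw [← hp] at h
  by_cases hex : ∃ t : ℝ≥0, N.reception u m ω p = t ∧ (N.graph t ω).Adj p v
  · obtain ⟨t, ht, hadj⟩ := hex
    refine ⟨p, t, ht, hadj.ne, h.trans (le_antisymm (iInf₂_le t ⟨ht, hadj⟩) ?_)⟩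
    refine le_iInf₂ fun t' ht' => ?_
    have : t = t' := by exact_mod_cast ht.symm.trans ht'.1
    rw [this]
  · refine absurd (h.trans ?_) hfin
    simp only [iInf_eq_top]
    exact fun t ht => absurd ⟨t, ht⟩ hex

/-- Latencies are positive, so a relay has strictly fewer predecessors than the node it serves. This
is the measure for inductions along the path of a message. -/
theorem ncard_earlier_lt (hN : IsP2PNetwork P N) {u : L} {m : ℕ} {ω : Ω} {p v : V} {t : ℝ≥0}
    (hp : N.reception u m ω p = t) (hpv : p ≠ v)
    (hv : N.reception u m ω v = ((t + N.w (some p) (some v) : ℝ≥0) : ℝ≥0∞)) :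
    (N.earlier u m ω p).ncard < (N.earlier u m ω v).ncard := by
  have hw : 0 < N.w (some p) (some v) := hN.w_pos _ _ (by simpa using hpv)
  have hlt : N.reception u m ω p < N.reception u m ω v := by
    rw [hp, hv]
    exact_mod_cast lt_add_of_pos_right t hw
  refine Set.ncard_lt_ncard ⟨fun a ha => lt_trans ha hlt, fun h => ?_⟩ (Set.toFinite _)
  exact lt_irrefl (N.reception u m ω p) (h hlt)

/-- Trace the message back through its relays and contract the path by the triangle inequality. -/
theorem broadcastTime_add_le_reception (hN : IsP2PNetwork P N) (u : L) (m : ℕ) (ω : Ω) (v : V)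
    (hv : v ≠ N.NID u) :
    N.broadcastTime u m ω + N.w (some (N.NID u)) (some v) ≤ N.reception u m ω v := by
  induction hk : (N.earlier u m ω v).ncard using Nat.strong_induction_on generalizing v with
  | _ k ih =>
    by_cases hfin : N.reception u m ω v = ⊤
    · rw [hfin]; exact le_top
    obtain ⟨p, t, hp, hpv, hr⟩ := hN.exists_relay hv hfin
    have hlt := hN.ncard_earlier_lt hp hpv hr
    rw [hr, ENNReal.coe_add, ← hp]
    by_cases hps : p = N.NID u
    · rw [hps, hN.reception_source]
    · refine le_trans ?_ (add_le_add_left (ih _ (hk ▸ hlt) p hps rfl) _)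
      rw [add_assoc]
      gcongr
      exact_mod_cast hN.triangle _ _ _

/-- Every hop back to a relay costs at most `maxLatency` and removes at least one predecessor. -/
theorem reception_le (hN : IsP2PNetwork P N) (u : L) (m : ℕ) (ω : Ω) (v : V)
    (hfin : N.reception u m ω v ≠ ⊤) :
    N.reception u m ω v ≤
      N.broadcastTime u m ω + ((N.earlier u m ω v).ncard * P.maxLatency : ℝ≥0) := by
  induction hk : (N.earlier u m ω v).ncard using Nat.strong_induction_on generalizing v with
  | _ k ih =>
    by_cases hv : v = N.NID u
    · rw [hv, hN.reception_source]; exact le_self_add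
    obtain ⟨p, t, hp, hpv, hr⟩ := hN.exists_relay hv hfin
    have hlt := hN.ncard_earlier_lt hp hpv hr
    rw [hk] at hlt
    have h1 := ih _ hlt p (by rw [hp]; exact ENNReal.coe_ne_top) rfl
    rw [hr, ENNReal.coe_add, ← hp]
    refine (add_le_add_left h1 _).trans ?_
    rw [add_assoc]
    gcongr
    rw [← ENNReal.coe_add, ENNReal.coe_le_coe]
    have h2 : (((N.earlier u m ω p).ncard + 1 : ℕ) : ℝ≥0) ≤ k := by exact_mod_cast hlt
    calc _ ≤ ((N.earlier u m ω p).ncard : ℝ≥0) * P.maxLatency + P.maxLatency := by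
          gcongr; exact hN.w_le _ _
      _ = (((N.earlier u m ω p).ncard + 1 : ℕ) : ℝ≥0) * P.maxLatency := by push_cast; ring
      _ ≤ k * P.maxLatency := by gcongr

/-- No copy of a message arrives before the one that the sender would deliver directly. -/
theorem broadcastTime_add_le_firstArrival (hN : IsP2PNetwork P N) (u : L) (m : ℕ) (ω : Ω) :
    N.broadcastTime u m ω + N.w (some (N.NID u)) none ≤ N.firstArrival u m ω := by
  refine le_iInf fun v => le_trans ?_ (N.reception_add_le_deliveryTime u m ω v)
  by_cases hv : v = N.NID u
  · rw [hv, hN.reception_source]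
  · refine le_trans ?_ (add_le_add_left (hN.broadcastTime_add_le_reception u m ω v hv) _)
    rw [add_assoc]
    gcongr
    exact_mod_cast hN.triangle _ _ _

/-- A node has at most `maxNodes - 1` predecessors; the last hop, to the agent, makes `maxNodes`.
The bound lets the agent infer from a late arrival that the broadcast was recent. -/
theorem firstArrival_le (hN : IsP2PNetwork P N) (u : L) (m : ℕ) (ω : Ω)
    (hfin : N.firstArrival u m ω ≠ ⊤) :
    N.firstArrival u m ω ≤ N.broadcastTime u m ω + (P.maxNodes * P.maxLatency : ℝ≥0) := by
  obtain ⟨v, hv⟩ : ∃ v, N.deliveryTime u m ω v ≠ ⊤ := by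
    by_contra! h
    exact hfin (by simp [NetworkData.firstArrival, h])
  obtain ⟨t, ht⟩ : ∃ t : ℝ≥0, N.reception u m ω v = t ∧ v ∈ N.peers t ω := by
    by_contra h
    refine hv ?_
    simp only [NetworkData.deliveryTime, iInf_eq_top]
    exact fun t ht => absurd ⟨t, ht⟩ h
  have h1 := hN.reception_le u m ω v (by rw [ht.1]; exact ENNReal.coe_ne_top)
  have hcard : (N.earlier u m ω v).ncard + 1 ≤ P.maxNodes := by
    refine le_trans ?_ hN.card_le
    rw [← Nat.card_eq_fintype_card, ← Set.ncard_univ]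
    refine Set.ncard_lt_ncard ⟨Set.subset_univ _, fun h => ?_⟩ (Set.toFinite _)
    exact lt_irrefl (N.reception u m ω v) (h (Set.mem_univ v))
  have h2 : (((N.earlier u m ω v).ncard + 1 : ℕ) : ℝ≥0) ≤ P.maxNodes := by exact_mod_cast hcard
  calc N.firstArrival u m ω ≤ N.deliveryTime u m ω v := iInf_le _ v
    _ ≤ ((t + N.w (some v) none : ℝ≥0) : ℝ≥0∞) := iInf₂_le t ht
    _ = N.reception u m ω v + N.w (some v) none := by rw [ht.1, ENNReal.coe_add]
    _ ≤ N.broadcastTime u m ω + ((N.earlier u m ω v).ncard * P.maxLatency : ℝ≥0)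
        + P.maxLatency := by gcongr; exact hN.w_le _ _
    _ ≤ _ := by
      rw [add_assoc]
      gcongr
      rw [← ENNReal.coe_add, ENNReal.coe_le_coe]
      calc _ = (((N.earlier u m ω v).ncard + 1 : ℕ) : ℝ≥0) * P.maxLatency := by push_cast; ring
        _ ≤ _ := by gcongr

/-- If the agent is a peer of the sender at the time of the broadcast, the direct copy comes
first. -/
theorem direct_delivery (hN : IsP2PNetwork P N) {u : L} {m : ℕ} {ω : Ω} {t : ℝ≥0}
    (ht : N.broadcastTime u m ω = t) (hp : N.NID u ∈ N.peers t ω) :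
    N.firstArrival u m ω = ((t + N.w (some (N.NID u)) none : ℝ≥0) : ℝ≥0∞) ∧
      N.firstPeer u m ω = some (N.NID u) := by
  have h1 : N.deliveryTime u m ω (N.NID u) ≤ ((t + N.w (some (N.NID u)) none : ℝ≥0) : ℝ≥0∞) :=
    iInf₂_le t ⟨by rw [hN.reception_source, ht], hp⟩
  have h2 := hN.broadcastTime_add_le_firstArrival u m ω
  rw [ht, ← ENNReal.coe_add] at h2
  have h3 : N.firstArrival u m ω ≤ N.deliveryTime u m ω (N.NID u) := iInf_le _ _
  have h4 : N.firstArrival u m ω = ((t + N.w (some (N.NID u)) none : ℝ≥0) : ℝ≥0∞) :=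
    le_antisymm (h3.trans h1) h2
  exact ⟨h4, hN.firstPeer_direct u m ω (by rw [h4]; exact ENNReal.coe_ne_top)
    (le_antisymm (h1.trans h2) h3)⟩

theorem lt_M_of_broadcastTime_lt (hN : IsP2PNetwork P N) {u : L} {m : ℕ} {ω : Ω} {b : ℝ≥0}
    (h : N.broadcastTime u m ω < b) : m < N.M u b ω := by
  simp only [NetworkData.broadcastTime, iInf_lt_iff] at h
  obtain ⟨t, ht, htb⟩ := h
  exact ht.trans_le (hN.M_mono u ω (by exact_mod_cast htb.le))

theorem le_broadcastTime (hN : IsP2PNetwork P N) {u : L} {m : ℕ} {ω : Ω} {a : ℝ≥0}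
    (h : N.M u a ω ≤ m) : a ≤ N.broadcastTime u m ω := by
  refine le_iInf₂ fun t ht => ?_
  by_contra! hlt
  have := hN.M_mono u ω (ENNReal.coe_le_coe.1 hlt.le)
  simp only at this
  omega

/-- A node that the agent requests becomes a peer as soon as the connections in some slot
expire. -/
theorem mem_peers_of_requests (hN : IsP2PNetwork P N) {v : V} {i : Fin (N.slots v)}
    {s t x : ℝ≥0} {ω : Ω} (hlong : ω ∉ N.longConnection v i s x) (hv : v ∈ N.nodes s ω)
    (hst : s + x ≤ t) (hreq : ∀ r ∈ Set.Icc s t, v ∈ N.requests r ω) : v ∈ N.peers t ω := by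
  by_contra hp
  obtain ⟨n, h1, h2, h3⟩ := hN.fcfs v s t ω (le_self_add.trans hst) hv hreq hp i
  obtain ⟨y, hy⟩ := Option.ne_none_iff_exists'.1 h3
  rw [hN.finish_eq v i n ω y hy] at h2
  -- The blocking connection began by time `s` and is still alive at `t ≥ s + x`, so its lifetime
  -- exceeds `x`.
  refine hlong ⟨n, ⟨h1, by simp [hy]⟩, ?_⟩
  have h4 : ((s + x : ℝ≥0) : ℝ≥0∞) < s + ENNReal.ofReal (N.lifetime v i n ω) :=
    (ENNReal.coe_le_coe.2 hst).trans_lt (h2.trans_le (by gcongr))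
  rw [ENNReal.coe_add] at h4
  have h5 := lt_of_add_lt_add_left h4
  rw [← ENNReal.ofReal_coe_nnreal] at h5
  exact (ENNReal.ofReal_lt_ofReal_iff_of_nonneg x.coe_nonneg).1 h5

end IsP2PNetwork

/-! ### Probabilities of the bad events. -/

theorem expMeasure_Ioi {r x : ℝ} (hr : 0 < r) (hx : 0 ≤ x) :
    expMeasure r (Set.Ioi x) = ENNReal.ofReal (Real.exp (-(r * x))) := by
  have := isProbabilityMeasure_expMeasure hr
  rw [← Set.compl_Iic, prob_compl_eq_one_sub measurableSet_Iic, ← ofReal_cdf,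
    cdf_expMeasure_eq hr, if_pos hx, ← ENNReal.ofReal_one,
    ← ENNReal.ofReal_sub _ (by simpa using mul_nonneg hr.le hx)]
  simp

namespace NetworkData

variable {V L Ω : Type*}

/-- The `n`-th connection in the slot `i` of `v` is established by time `s`, and its other end
is not the agent. -/
def startedBy (N : NetworkData V L Ω) (v : V) (i : Fin (N.slots v)) (s : ℝ≥0) (n : ℕ) : Set Ω :=
  {ω | N.start v i n ω ≤ s ∧ (N.occupant v i n ω).isNone = false}

end NetworkData

/-- Connections in one slot do not overlap, so that at most `s + 1` of those established by
time `s` last longer than `1`. -/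
theorem IsP2PNetwork.sum_long_le {P : NetParams} {V L Ω : Type*} [Fintype V]
    {N : NetworkData V L Ω} (hN : IsP2PNetwork P N) (v : V)
    (i : Fin (N.slots v)) (s : ℝ≥0) (ω : Ω) (n : ℕ) :
    ∑ m ∈ Finset.range n,
      (N.startedBy v i s m ∩ {ω | 1 < N.lifetime v i m ω}).indicator (1 : Ω → ℝ≥0∞) ω ≤
        min (N.start v i n ω) (s + 1) := by
  -- Both entries of the minimum are needed: a long connection delays the next start by at least
  -- `1`, which preserves the first entry; if it starts by `s`, the sum before it is at most `s`,
  -- which gives the second.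
  induction n with
  | zero => simp
  | succ n ih =>
    rw [Finset.sum_range_succ]
    by_cases h : ω ∈ N.startedBy v i s n ∩ {ω | 1 < N.lifetime v i n ω}
    · rw [Set.indicator_of_mem h]
      obtain ⟨⟨h1, h2⟩, h3⟩ := h
      obtain ⟨y, hy⟩ := Option.ne_none_iff_exists'.1
        (fun e => by simp [e] at h2 : N.occupant v i n ω ≠ none)
      have h4 := hN.finish_le_start v i n ω
      rw [hN.finish_eq v i n ω y hy] at h4
      have h5 : 1 ≤ ENNReal.ofReal (N.lifetime v i n ω) := by
        rw [← ENNReal.ofReal_one]; exact ENNReal.ofReal_le_ofReal (le_of_lt h3)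
      refine le_min ?_ ?_
      · exact (add_le_add (ih.trans (min_le_left _ _)) h5).trans h4
      · exact add_le_add (ih.trans ((min_le_left _ _).trans h1)) le_rfl
    · rw [Set.indicator_of_notMem h, add_zero]
      exact ih.trans (min_le_min_right _
        ((hN.start_le_finish v i n ω).trans (hN.finish_le_start v i n ω)))

section Liveness

variable {P : NetParams} {V L Ω : Type*} [MeasurableSpace Ω] {N : NetworkData V L Ω}
  {T : Set L} {μ : Measure Ω}

theorem IsLive.measurableSet_startedBy (hL : IsLive P.lam P.nu N T μ) (v : V)
    (i : Fin (N.slots v)) (s : ℝ≥0) (n : ℕ) : MeasurableSet (N.startedBy v i s n) :=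
  (measurableSet_le (hL.measurable_start v i n) measurable_const).inter
    (hL.measurable_occupant v i n (measurableSet_singleton false))

theorem IsLive.measure_startedBy_inter (hL : IsLive P.lam P.nu N T μ) (v : V)
    (i : Fin (N.slots v)) (s : ℝ≥0) (n : ℕ) {x : ℝ} (hx : 0 ≤ x) :
    μ (N.startedBy v i s n ∩ {ω | x < N.lifetime v i n ω}) =
      ENNReal.ofReal (Real.exp (-(P.lam * x))) * μ (N.startedBy v i s n) := by
  have h := (hL.lifetime_indep v i n).measure_inter_preimage_eq_mul (Set.Ioi x)
    (Set.Iic (s : ℝ≥0∞) ×ˢ {false}) measurableSet_Ioi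
    (measurableSet_Iic.prod (measurableSet_singleton _))
  have h1 := (hL.lifetime_law v i n).map_eq
  have h2 : μ (N.lifetime v i n ⁻¹' Set.Ioi x) = expMeasure P.lam (Set.Ioi x) := by
    rw [← h1, Measure.map_apply_of_aemeasurable (hL.lifetime_law v i n).aemeasurable
      measurableSet_Ioi]
  rw [h2, expMeasure_Ioi P.lam_pos hx] at h
  rw [Set.inter_comm]
  exact h

/-- The union bound over all connections in the slot needs the sum of the probabilities of
`startedBy`. Comparing each of them with the event of lasting longer than `1` turns this sum into an
expectation that `sum_long_le` bounds pathwise. -/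
theorem IsLive.measure_longConnection_le [Fintype V] [IsProbabilityMeasure μ]
    (hN : IsP2PNetwork P N) (hL : IsLive P.lam P.nu N T μ) (v : V) (i : Fin (N.slots v))
    (s x : ℝ≥0) :
    μ (N.longConnection v i s x) ≤
      ENNReal.ofReal (Real.exp P.lam * Real.exp (-(P.lam * x)) * (s + 1)) := by
  set A : ℕ → Set Ω := fun n => N.startedBy v i s n ∩ {ω | 1 < N.lifetime v i n ω} with hA
  have hmeas : ∀ n, NullMeasurableSet (A n) μ := fun n =>
    (hL.measurableSet_startedBy v i s n).nullMeasurableSet.inter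
      ((hL.lifetime_law v i n).aemeasurable.nullMeasurable measurableSet_Ioi)
  have hsum : ∑' n, μ (A n) ≤ s + 1 := by
    calc ∑' n, μ (A n) = ∑' n, ∫⁻ ω, (A n).indicator 1 ω ∂μ := by
          refine tsum_congr fun n => (lintegral_indicator_one₀ (hmeas n)).symm
      _ = ∫⁻ ω, ∑' n, (A n).indicator 1 ω ∂μ :=
          (lintegral_tsum fun n => aemeasurable_one.indicator₀ (hmeas n)).symm
      _ ≤ ∫⁻ _, (s + 1 : ℝ≥0∞) ∂μ := by
          refine lintegral_mono fun ω => ENNReal.tsum_le_of_sum_range_le fun n => ?_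
          exact (hN.sum_long_le v i s ω n).trans (min_le_right _ _)
      _ = s + 1 := by simp
  have hstart : ∀ n, μ (N.startedBy v i s n) = ENNReal.ofReal (Real.exp P.lam) * μ (A n) := by
    intro n
    rw [hA, hL.measure_startedBy_inter v i s n zero_le_one, ← mul_assoc,
      ← ENNReal.ofReal_mul (Real.exp_nonneg _), ← Real.exp_add]
    simp
  calc μ (N.longConnection v i s x)
      = μ (⋃ n, N.startedBy v i s n ∩ {ω | (x : ℝ) < N.lifetime v i n ω}) := by
        congr 1; ext ω; simp [NetworkData.longConnection, NetworkData.startedBy]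
    _ ≤ ∑' n, μ (N.startedBy v i s n ∩ {ω | (x : ℝ) < N.lifetime v i n ω}) :=
        measure_iUnion_le _
    _ = ∑' n, ENNReal.ofReal (Real.exp P.lam * Real.exp (-(P.lam * x))) * μ (A n) := by
        refine tsum_congr fun n => ?_
        rw [hL.measure_startedBy_inter v i s n x.coe_nonneg, hstart, ← mul_assoc,
          ← ENNReal.ofReal_mul (Real.exp_nonneg _), mul_comm (Real.exp P.lam)]
    _ ≤ ENNReal.ofReal (Real.exp P.lam * Real.exp (-(P.lam * x))) * (s + 1) := by
        rw [ENNReal.tsum_mul_left]; gcongr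
    _ = _ := by
        rw [ENNReal.ofReal_mul (by positivity) (q := (s : ℝ) + 1),
          ENNReal.ofReal_add s.coe_nonneg zero_le_one]
        simp

theorem IsPoissonProcess.measure_no_arrival {nu : ℝ≥0} {M : ℝ≥0 → Ω → ℕ}
    (hM : IsPoissonProcess nu M μ) (a x : ℝ≥0) :
    μ {ω | M (a + x) ω ≤ M a ω} = ENNReal.ofReal (Real.exp (-(nu * x))) := by
  have h := hM.law a (a + x) le_self_add
  have h1 : {ω | M (a + x) ω ≤ M a ω} = (fun ω => M (a + x) ω - M a ω) ⁻¹' {0} := by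
    ext ω; simp [Nat.sub_eq_zero_iff_le]
  rw [h1, ← Measure.map_apply_of_aemeasurable h.aemeasurable (measurableSet_singleton _),
    h.map_eq, poissonMeasure_singleton]
  simp

/-- A node that is always present is missed by `n` queries with probability at most
`(1 - q) ^ n`. -/
theorem HasOracleLaw.measure_missed_le [IsProbabilityMeasure μ] (hO : HasOracleLaw P N μ)
    (v : V) (hv : ∀ s ω, v ∈ N.nodes s ω) (s : ℕ → ℝ≥0) (hs : ∀ n, s n + P.tau ≤ s (n + 1))
    (n : ℕ) :
    μ {ω | ∀ m < n, N.oracle (s m) ω ≠ v} ≤ ENNReal.ofReal (Real.exp (-(P.q * n))) := by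
  have hmono : Monotone s := monotone_nat_of_le_succ fun n => le_self_add.trans (hs n)
  induction n with
  | zero => simp
  | succ n ih =>
    set A : Set Ω := {ω | ∀ m < n, N.oracle (s m) ω ≠ v} with hA
    have hAeq : A = ⋂ (m : ℕ) (_ : m < n), {ω | N.oracle (s m) ω = v}ᶜ := by
      ext ω; simp [hA]
    -- The spacing of the queries puts all earlier answers into the history on which the next draw
    -- is conditioned.
    have hmeas : MeasurableSet[N.oracleHistory P (s n)] A := by
      rw [hAeq]
      refine MeasurableSet.iInter fun m => MeasurableSet.iInter fun hm =>
        MeasurableSet.compl ?_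
      have h1 : s m + P.tau ≤ s n := (hs m).trans (hmono hm)
      have h2 : MeasurableSpace.comap (N.oracle (s m)) ⊤ ≤ N.oracleHistory P (s n) :=
        le_iSup₂_of_le (s m) h1 le_rfl
      exact h2 _ ⟨{v}, trivial, rfl⟩
    have h := hO.le_draw (s n) v A hmeas
    have huniv : {ω | v ∈ N.nodes (s n) ω} = Set.univ := by ext ω; simp [hv]
    rw [huniv, Set.inter_univ] at h
    have hsplit : μ (A ∩ {ω | N.oracle (s n) ω = v}) + μ (A \ {ω | N.oracle (s n) ω = v}) = μ A :=
      measure_inter_add_sdiff _ (hO.measurable _ _)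
    have hsub : {ω | ∀ m < n + 1, N.oracle (s m) ω ≠ v} =
        A \ {ω | N.oracle (s n) ω = v} := by
      ext ω
      simp only [hA, Set.mem_ofPred_eq, Set.mem_sdiff]
      exact ⟨fun h => ⟨fun m hm => h m (by omega), h n (by omega)⟩, fun h m hm => by
        rcases Nat.lt_succ_iff_lt_or_eq.1 hm with hm | rfl
        exacts [h.1 m hm, h.2]⟩
    rw [hsub]
    have h3 : (μ (A \ {ω | N.oracle (s n) ω = v})).toReal ≤ (1 - P.q) * (μ A).toReal := by
      have e1 := congrArg ENNReal.toReal hsplit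
      rw [ENNReal.toReal_add (measure_ne_top _ _) (measure_ne_top _ _)] at e1
      have e2 := ENNReal.toReal_mono (measure_ne_top _ _) h
      rw [ENNReal.toReal_mul, ENNReal.coe_toReal] at e2
      linarith
    rw [← ENNReal.ofReal_toReal (measure_ne_top μ (A \ _))]
    refine ENNReal.ofReal_le_ofReal (h3.trans ?_)
    have h4 : (μ A).toReal ≤ Real.exp (-(P.q * n)) := by
      exact ENNReal.toReal_le_of_le_ofReal (Real.exp_nonneg _) ih
    calc (1 - P.q) * (μ A).toReal ≤ Real.exp (-P.q) * Real.exp (-(P.q * n)) := by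
          gcongr
          have := Real.add_one_le_exp (-(P.q : ℝ))
          linarith
      _ = _ := by rw [← Real.exp_add]; congr 1; push_cast; ring

end Liveness

/-! ### Choice of the parameters. -/

/-- A logarithmic number of rounds of logarithmic length makes the failure probability small. -/
theorem exists_rounds_and_length (lam nu q K : ℝ) (hlam : 0 < lam) (hnu : 0 < nu) (hq : 0 < q)
    (hK : 1 ≤ K) :
    ∃ A B : ℝ, 0 < A ∧ 0 < B ∧ ∀ X : ℝ, 1 ≤ X → ∃ (R : ℕ) (x : ℝ), 0 < R ∧ 0 ≤ x ∧
      R ≤ A * (1 + Real.log X) ∧ x ≤ B * (1 + Real.log X) ∧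
      X * Real.exp (-(q * (R - 1 : ℕ))) + X * (X * R) * Real.exp (-(nu * x)) +
        X * (X * R + 1) * (Real.exp lam * Real.exp (-(lam * x)) * (X * R * (2 * x + K) + 1))
          ≤ 1 := by
  set A : ℝ := 2 / q + 2 with hA
  set θ : ℝ := min lam nu with hθ
  have hθ0 : 0 < θ := lt_min hlam hnu
  set G : ℝ := 4 / θ + K + 1 with hG
  -- `H` is three times the sum of the coefficients of `X ^ 5 * E` in `t2` and `t3`, and `x` will be
  -- chosen so that `H * X ^ 5 * E = 1`. The first summand and the other two together are then at
  -- most `1 / 3` each.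
  set H : ℝ := 6 * A ^ 2 * Real.exp lam * G + 3 * A with hH
  have hA2 : 2 ≤ A := by rw [hA]; have := div_pos two_pos hq; linarith
  have hG0 : 0 < G := by positivity
  have hH1 : 1 ≤ H := by
    have : 0 ≤ 6 * A ^ 2 * Real.exp lam * G := by positivity
    linarith
  have hlogH : 0 ≤ Real.log H := Real.log_nonneg hH1
  refine ⟨A, 2 / θ * (5 + Real.log H), by linarith, by positivity, fun X hX => ?_⟩
  have hX0 : 0 < X := by linarith
  have hlogX : 0 ≤ Real.log X := Real.log_nonneg hX
  have hlogX' : 1 + Real.log X ≤ X := by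
    have := Real.log_le_sub_one_of_pos hX0; linarith
  have hlog3 : Real.log (3 * X) ≤ 2 + Real.log X := by
    rw [Real.log_mul (by norm_num) hX0.ne']
    have := Real.log_le_sub_one_of_pos (show (0 : ℝ) < 3 by norm_num)
    linarith
  have hlog3' : 0 ≤ Real.log (3 * X) := Real.log_nonneg (by linarith)
  set R : ℕ := ⌈Real.log (3 * X) / q⌉₊ + 1 with hR
  set x : ℝ := 2 / θ * (5 * Real.log X + Real.log H) with hx
  have hx0 : 0 ≤ x := by positivity
  have hRA : (R : ℝ) ≤ A * (1 + Real.log X) := by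
    have h1 := Nat.ceil_lt_add_one (div_nonneg hlog3' hq.le)
    have h2 : Real.log (3 * X) / q ≤ 2 / q * (1 + Real.log X) := by
      rw [div_mul_eq_mul_div]; gcongr; linarith
    rw [hR, hA]; push_cast; nlinarith
  have hRX : (R : ℝ) ≤ A * X := hRA.trans (by gcongr)
  have hR0 : (0 : ℝ) ≤ R := R.cast_nonneg
  refine ⟨R, x, by omega, hx0, hRA, ?_, ?_⟩
  · rw [hx, mul_assoc]; gcongr; nlinarith
  have hdecay : H * X ^ 5 * Real.exp (-(θ * x / 2)) = 1 := by
    have e : -(θ * x / 2) = -(Real.log (H * X ^ 5)) := by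
      rw [Real.log_mul (by positivity) (by positivity), Real.log_pow, hx]
      push_cast; field_simp; ring
    rw [e, Real.exp_neg, Real.exp_log (by positivity)]
    exact mul_inv_cancel₀ (by positivity)
  -- The decay is split into two factors `E`: one absorbs the linear growth of `2 * x + K`, the
  -- other beats `X ^ 5`.
  set E : ℝ := Real.exp (-(θ * x / 2)) with hE
  have hE0 : 0 < E := Real.exp_pos _
  have hE1 : E ≤ 1 := Real.exp_le_one_iff.2 (by
    have : 0 ≤ θ * x / 2 := by positivity
    linarith)
  have hEE : Real.exp (-(θ * x)) = E * E := by rw [hE, ← Real.exp_add]; congr 1; ring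
  have hnuE : Real.exp (-(nu * x)) ≤ E := by
    calc Real.exp (-(nu * x)) ≤ Real.exp (-(θ * x)) := by gcongr; exact min_le_right _ _
      _ = E * E := hEE
      _ ≤ E := by nlinarith
  have hlamE : Real.exp (-(lam * x)) ≤ E * E := by
    rw [← hEE]; gcongr; exact min_le_left _ _
  have hGE : (2 * x + K + 1) * E ≤ G := by
    have h1 : θ * x / 2 * E ≤ 1 := by
      have h2 := Real.add_one_le_exp (θ * x / 2)
      rw [hE, Real.exp_neg, ← div_eq_mul_inv, div_le_one (Real.exp_pos _)]
      linarith
    have h3 : 2 * x * E = 4 / θ * (θ * x / 2 * E) := by field_simp; ring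
    have h4 : 4 / θ * (θ * x / 2 * E) ≤ 4 / θ * 1 := by gcongr
    have h5 : (K + 1) * E ≤ (K + 1) * 1 := by gcongr
    rw [hG]; linarith
  have hX2 : 1 ≤ X ^ 2 := one_le_pow₀ hX
  have t1 : X * Real.exp (-(q * (R - 1 : ℕ))) ≤ 1 / 3 := by
    have h1 : Real.log (3 * X) ≤ q * (R - 1 : ℕ) := by
      have := Nat.le_ceil (Real.log (3 * X) / q)
      rw [div_le_iff₀ hq] at this
      simp only [hR, Nat.add_sub_cancel]; linarith
    calc X * Real.exp (-(q * (R - 1 : ℕ))) ≤ X * Real.exp (-(Real.log (3 * X))) := by gcongr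
      _ = 1 / 3 := by
        rw [Real.exp_neg, Real.exp_log (by positivity)]; field_simp
  have t2 : X * (X * R) * Real.exp (-(nu * x)) ≤ A * X ^ 5 * E := by
    calc X * (X * R) * Real.exp (-(nu * x)) ≤ X * (X * (A * X)) * E := by gcongr
      _ = A * X ^ 3 * E := by ring
      _ ≤ A * X ^ 5 * E := by gcongr; norm_num
  have hXR : X * R ≤ A * X ^ 2 := by
    calc X * R ≤ X * (A * X) := by gcongr
      _ = _ := by ring
  have hAX : 1 ≤ A * X ^ 2 := by nlinarith
  have t3 : X * (X * R + 1) * (Real.exp lam * Real.exp (-(lam * x)) *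
      (X * R * (2 * x + K) + 1)) ≤ 2 * A ^ 2 * Real.exp lam * G * X ^ 5 * E := by
    have h1 : X * R + 1 ≤ 2 * (A * X ^ 2) := by linarith
    have h2 : X * R * (2 * x + K) + 1 ≤ A * X ^ 2 * (2 * x + K + 1) := by
      have : X * R * (2 * x + K) ≤ A * X ^ 2 * (2 * x + K) := by gcongr
      linarith
    calc _ ≤ X * (2 * (A * X ^ 2)) *
          (Real.exp lam * (E * E) * (A * X ^ 2 * (2 * x + K + 1))) := by gcongr
      _ = 2 * A ^ 2 * Real.exp lam * X ^ 5 * E * ((2 * x + K + 1) * E) := by ring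
      _ ≤ 2 * A ^ 2 * Real.exp lam * X ^ 5 * E * G := by gcongr
      _ = _ := by ring
  have key : A * X ^ 5 * E + 2 * A ^ 2 * Real.exp lam * G * X ^ 5 * E = 1 / 3 := by
    rw [← hdecay, hH]; ring
  linarith

/-! ### Sample-path analysis of the strategy. -/

namespace Peri

variable {P : NetParams} {V L Ω : Type*} {r : ℕ} {S : PeriSchedule P} {tgt : Fin r → L}
  {N : NetworkData V L Ω}

theorem requests_eq (hF : (peri S V tgt).Follows N) {n : ℕ} {t : ℝ≥0} (h1 : n * S.len ≤ t)
    (h2 : t < (n + 1) * S.len) (ω : Ω) :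
    N.requests t ω = roundRequests S tgt (N.view ω) n := by
  have : ⌊t / S.len⌋₊ = n := by
    rw [Nat.floor_eq_iff (by simp)]
    exact ⟨(le_div_iff₀ S.len_pos).2 h1, (div_lt_iff₀ S.len_pos).2 h2⟩
  rw [hF t ω]
  simp only [peri, this]

/-- The horizon is the right end of the final round, which the half-open interval of `requests_eq`
omits. -/
theorem requests_eq_final (hF : (peri S V tgt).Follows N) {t : ℝ≥0}
    (h : (r * S.rounds : ℕ) * S.len ≤ t) (ω : Ω) :
    N.requests t ω = finalRequests S tgt (N.view ω) := by
  have : r * S.rounds ≤ ⌊t / S.len⌋₊ := Nat.le_floor ((le_div_iff₀ S.len_pos).2 h)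
  rw [hF t ω]
  simp only [peri, roundRequests, if_pos this]

theorem kept_succ {n : ℕ} {i : Fin r} (hn : n / S.rounds = i) (y : AgentView V L) :
    kept S tgt y (n + 1) = (heard y (tgt i) (n * S.len + S.warm) ((n + 1) * S.len)).or
      (kept S tgt y n) := by
  have h : n / S.rounds < r := hn ▸ i.2
  have e : (⟨n / S.rounds, h⟩ : Fin r) = i := Fin.ext hn
  rw [kept, dif_pos h, e]

variable [Fintype V] {x : ℝ≥0} {ω : Ω}

/-- In a round in which the agent requests the sender and gets the connection during the first
part of the waiting time, each new message is first delivered by the sender. -/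
theorem firstPeer_eq (hN : IsP2PNetwork P N)
    (hwarm : S.warm = x + P.maxNodes * P.maxLatency) {u : L} {n m : ℕ}
    (hpeer : ∀ t, n * S.len + x ≤ t → t < (n + 1) * S.len → N.NID u ∈ N.peers t ω)
    (hm : N.firstArrival u m ω ∈
      Set.Ico ((n * S.len + S.warm : ℝ≥0) : ℝ≥0∞) ((n + 1) * S.len : ℝ≥0)) :
    N.firstPeer u m ω = some (N.NID u) := by
  have hfin : N.firstArrival u m ω ≠ ⊤ := (hm.2.trans ENNReal.coe_lt_top).ne
  have h1 := hN.broadcastTime_add_le_firstArrival u m ω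
  have h2 := hN.firstArrival_le u m ω hfin
  have h3 : N.broadcastTime u m ω < ((n + 1) * S.len : ℝ≥0) :=
    (le_self_add.trans h1).trans_lt hm.2
  obtain ⟨t, ht⟩ : ∃ t : ℝ≥0, (t : ℝ≥0∞) = N.broadcastTime u m ω :=
    ⟨_, ENNReal.coe_toNNReal (h3.trans ENNReal.coe_lt_top).ne⟩
  refine (hN.direct_delivery ht.symm (hpeer t ?_ ?_)).2
  -- Arrival after `warm` and a spreading time of at most `maxNodes * maxLatency` put the broadcast
  -- at least `x` into the round.
  · have h4 := hm.1.trans h2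
    rw [← ht, ← ENNReal.coe_add, ENNReal.coe_le_coe, hwarm, ← add_assoc] at h4
    exact le_of_add_le_add_right h4
  · rw [← ht] at h3
    exact ENNReal.coe_lt_coe.1 h3

/-- This keeps a target that is already kept: a round without arrivals does no harm. -/
theorem heard_eq_none_or (hN : IsP2PNetwork P N)
    (hwarm : S.warm = x + P.maxNodes * P.maxLatency) {u : L} {n : ℕ}
    (hpeer : ∀ t, n * S.len + x ≤ t → t < (n + 1) * S.len → N.NID u ∈ N.peers t ω) :
    heard (N.view ω) u (n * S.len + S.warm) ((n + 1) * S.len) = none ∨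
      heard (N.view ω) u (n * S.len + S.warm) ((n + 1) * S.len) = some (N.NID u) := by
  unfold heard
  split_ifs with h
  · exact Or.inr (firstPeer_eq hN hwarm hpeer h.choose_spec.1)
  · exact Or.inl rfl

/-- This is how a newly connected target gets kept: a broadcast within `x` after `warm` reaches the
agent directly before the round ends. -/
theorem heard_eq_some (hN : IsP2PNetwork P N)
    (hwarm : S.warm = x + P.maxNodes * P.maxLatency) (hlen : S.warm + x + P.maxLatency < S.len)
    {u : L} {n : ℕ}
    (hpeer : ∀ t, n * S.len + x ≤ t → t < (n + 1) * S.len → N.NID u ∈ N.peers t ω)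
    (hmsg : N.M u (n * S.len + S.warm) ω < N.M u (n * S.len + S.warm + x) ω) :
    heard (N.view ω) u (n * S.len + S.warm) ((n + 1) * S.len) = some (N.NID u) := by
  set a : ℝ≥0 := n * S.len + S.warm with ha
  set b : ℝ≥0 := (n + 1) * S.len with hb
  have hab : a + x + P.maxLatency < b := by
    calc a + x + P.maxLatency = n * S.len + (S.warm + x + P.maxLatency) := by rw [ha]; ring
      _ < n * S.len + S.len := by gcongr
      _ = b := by rw [hb]; ring
  obtain ⟨m, hm⟩ : ∃ m, N.firstArrival u m ω ∈ Set.Ico (a : ℝ≥0∞) b := by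
    -- Serial numbers start at `0`, so this is the next message after those counted up to time `a`.
    refine ⟨N.M u a ω, ?_⟩
    have h1 : (a : ℝ≥0∞) ≤ N.broadcastTime u (N.M u a ω) ω := hN.le_broadcastTime le_rfl
    have h2 : N.broadcastTime u (N.M u a ω) ω ≤ (a + x : ℝ≥0) := iInf₂_le (a + x) hmsg
    obtain ⟨t, ht⟩ : ∃ t : ℝ≥0, (t : ℝ≥0∞) = N.broadcastTime u (N.M u a ω) ω :=
      ⟨_, ENNReal.coe_toNNReal (h2.trans_lt ENNReal.coe_lt_top).ne⟩
    rw [← ht, ENNReal.coe_le_coe] at h1 h2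
    have h3 := hN.direct_delivery ht.symm (hpeer t
      (le_trans (by rw [ha, hwarm]; gcongr; exact le_self_add) h1)
      (h2.trans_lt (le_self_add.trans_lt hab)))
    rw [h3.1]
    refine ⟨ENNReal.coe_le_coe.2 (h1.trans le_self_add), ENNReal.coe_lt_coe.2 ?_⟩
    exact (add_le_add h2 (hN.w_le _ _)).trans_lt hab
  -- Finiteness guarantees an earliest arrival, without which `heard` would be `none`.
  have hfin : {m | N.firstArrival u m ω ∈ Set.Ico (a : ℝ≥0∞) b}.Finite := by
    refine (Set.finite_Iio (N.M u b ω)).subset fun m hm => ?_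
    exact hN.lt_M_of_broadcastTime_lt
      ((le_self_add.trans (hN.broadcastTime_add_le_firstArrival u m ω)).trans_lt hm.2)
  obtain ⟨m₀, hm₀, hmin⟩ := Set.exists_min_image _ (fun m => N.firstArrival u m ω) hfin ⟨m, hm⟩
  have hex : ∃ m, FirstIn (N.view ω) u a b m := ⟨m₀, hm₀, fun m' hm' => hmin m' hm'⟩
  unfold heard
  rw [dif_pos hex]
  exact firstPeer_eq hN hwarm hpeer hex.choose_spec.1

theorem mem_peers_of_roundRequests (hN : IsP2PNetwork P N) (hF : (peri S V tgt).Follows N)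
    {v : V} {s : Fin (N.slots v)} {n : ℕ} (hv : v ∈ N.nodes (n * S.len) ω)
    (hslot : ω ∉ N.longConnection v s (n * S.len) x)
    (hreq : v ∈ roundRequests S tgt (N.view ω) n) :
    ∀ t, n * S.len + x ≤ t → t < (n + 1) * S.len → v ∈ N.peers t ω := by
  intro t h1 h2
  refine hN.mem_peers_of_requests hslot hv h1 fun t' ht' => ?_
  rw [requests_eq hF ht'.1 (ht'.2.trans_lt h2)]
  exact hreq

/-- The target `i` is found if, in each of its rounds, some slot of its node becomes free and it
broadcasts a message in time, and if the oracle draws it in one of these rounds but the last. -/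
theorem found_eq (hN : IsP2PNetwork P N) (hF : (peri S V tgt).Follows N)
    (hwarm : S.warm = x + P.maxNodes * P.maxLatency) (hlen : S.warm + x + P.maxLatency < S.len)
    (i : Fin r) (s : Fin (N.slots (N.NID (tgt i)))) (hv : ∀ t, N.NID (tgt i) ∈ N.nodes t ω)
    (hslot : ∀ n ≤ r * S.rounds, ω ∉ N.longConnection _ s (n * S.len) x)
    (hmsg : ∀ n < r * S.rounds, N.M (tgt i) (n * S.len + S.warm) ω <
      N.M (tgt i) (n * S.len + S.warm + x) ω)
    (hdraw : ∃ m < S.rounds - 1, N.oracle ((i * S.rounds + m : ℕ) * S.len) ω = N.NID (tgt i)) :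
    found S tgt (N.view ω) i = some (N.NID (tgt i)) := by
  classical
  obtain ⟨m, hm, hdraw⟩ := hdraw
  have hiR : (i + 1) * S.rounds ≤ r * S.rounds := Nat.mul_le_mul_right _ i.2
  have hsucc : (i + 1) * S.rounds = i * S.rounds + S.rounds := by ring
  have hdiv : ∀ n, i * S.rounds ≤ n → n < (i + 1) * S.rounds → n / S.rounds = i := fun n h1 h2 =>
    Nat.div_eq_of_lt_le h1 h2
  -- A node drawn in round `i * S.rounds + m` is requested in the next round and kept from the
  -- beginning of the one after; hence the `+ 2`.
  have hstay : ∀ l, l + (i * S.rounds + m + 2) ≤ (i + 1) * S.rounds →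
      kept S tgt (N.view ω) (l + (i * S.rounds + m + 2)) = some (N.NID (tgt i)) := by
    intro l
    induction l with
    | zero =>
      intro hl
      have hreq : N.NID (tgt i) ∈ roundRequests S tgt (N.view ω) (i * S.rounds + m + 1) := by
        unfold roundRequests
        rw [if_neg (by omega), if_neg (by omega)]
        -- The first query of a round suffices for the estimate.
        refine Finset.mem_union_right _ (Finset.mem_image.2 ⟨0, ?_, ?_⟩)
        · have := P.two_le_k
          simp; omega
        · simpa [NetworkData.view] using hdraw
      have hpeer := mem_peers_of_roundRequests hN hF (hv _) (hslot _ (by omega)) hreq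
      rw [show 0 + (i * S.rounds + m + 2) = (i * S.rounds + m + 1) + 1 by omega,
        kept_succ (hdiv _ (by omega) (by omega)),
        heard_eq_some hN hwarm hlen hpeer (hmsg _ (by omega)), Option.some_or]
    | succ l ih =>
      intro hl
      have hk := ih (by omega)
      set n := l + (i * S.rounds + m + 2) with hn
      have hreq : N.NID (tgt i) ∈ roundRequests S tgt (N.view ω) n := by
        unfold roundRequests
        rw [if_neg (by omega), if_neg (by omega), hk]
        exact Finset.mem_union_left _ (by simp)
      have hpeer := mem_peers_of_roundRequests hN hF (hv _) (hslot _ (by omega)) hreq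
      rw [show l + 1 + (i * S.rounds + m + 2) = n + 1 by omega,
        kept_succ (hdiv _ (by omega) (by omega)), hk]
      rcases heard_eq_none_or hN hwarm hpeer with h | h <;> rw [h] <;> rfl
  have := hstay (S.rounds - 2 - m) (by omega)
  rwa [show S.rounds - 2 - m + (i * S.rounds + m + 2) = (i + 1) * S.rounds by omega] at this

/-- The final round lasts at least `x`, enough for a slot of each announced target to become free.
-/
theorem not_failsAt (hN : IsP2PNetwork P N) (hF : (peri S V tgt).Follows N)
    (hxlen : x ≤ S.len) (s : ∀ v, Fin (N.slots v)) (hv : ∀ i t, N.NID (tgt i) ∈ N.nodes t ω)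
    (hslot : ∀ i, ω ∉ N.longConnection (N.NID (tgt i)) (s _) ((r * S.rounds : ℕ) * S.len) x)
    (hfound : ∀ i, found S tgt (N.view ω) i = some (N.NID (tgt i))) :
    ¬ (peri S V tgt).FailsAt N tgt ω := by
  classical
  unfold Strategy.FailsAt
  rw [not_not]
  refine ⟨hfound, fun hrk i => ?_⟩
  refine hN.mem_peers_of_requests (hslot i) (hv i _) ?_ fun t ht => ?_
  · simp only [peri]
    push_cast
    rw [add_mul, one_mul]
    gcongr
  · rw [requests_eq_final hF ht.1]
    have hcard : (Finset.univ.biUnion fun i => (found S tgt (N.view ω) i).toFinset).card ≤ P.k :=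
      calc _ ≤ ∑ i : Fin r, (found S tgt (N.view ω) i).toFinset.card := Finset.card_biUnion_le
        _ = r := by simp [hfound]
        _ ≤ P.k := hrk
    unfold finalRequests
    rw [if_pos hcard]
    exact Finset.mem_biUnion.2 ⟨i, Finset.mem_univ _, by simp [hfound]⟩

/-! ### Union bound and conclusion. -/

/-- The union bound for the failure probability. -/
theorem measure_failsAt_le [MeasurableSpace Ω] (μ : Measure Ω) [IsProbabilityMeasure μ]
    (hN : IsP2PNetwork P N) (hO : HasOracleLaw P N μ)
    (hL : IsLive P.lam P.nu N (Set.range tgt) μ) (hF : (peri S V tgt).Follows N)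
    (h0 : ∀ i ω, N.NID (tgt i) ∈ N.nodes 0 ω)
    (hwarm : S.warm = x + P.maxNodes * P.maxLatency)
    (hlen : S.warm + x + P.maxLatency < S.len) :
    μ {ω | (peri S V tgt).FailsAt N tgt ω} ≤ ENNReal.ofReal
      (r * (Real.exp (-(P.q * (S.rounds - 1 : ℕ))) + r * S.rounds * Real.exp (-(P.nu * x)) +
        (r * S.rounds + 1) * (Real.exp P.lam * Real.exp (-(P.lam * x)) *
          (r * S.rounds * S.len + 1)))) := by
  have hv : ∀ i t ω, N.NID (tgt i) ∈ N.nodes t ω := fun i t ω =>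
    hN.nodes_mono 0 t ω zero_le (h0 i ω)
  let s : ∀ v, Fin (N.slots v) := fun v => ⟨0, P.F_pos.trans_le (hN.le_slots v)⟩
  have hxlen : x ≤ S.len := by
    refine le_trans ?_ hlen.le
    rw [hwarm, add_assoc, add_assoc]
    exact le_self_add
  have htau : P.tau ≤ S.len := by
    refine le_trans ?_ S.queries_le
    have : (1 : ℝ≥0) ≤ ((P.k - 1 : ℕ) : ℝ≥0) := by
      have := P.two_le_k
      exact_mod_cast (by omega : 1 ≤ P.k - 1)
    calc P.tau = 1 * P.tau := (one_mul _).symm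
      _ ≤ _ := by gcongr
  set missed : Fin r → Set Ω := fun i =>
    {ω | ∀ m < S.rounds - 1, N.oracle ((i * S.rounds + m : ℕ) * S.len) ω ≠ N.NID (tgt i)}
    with hmissed
  set silent : Fin r → ℕ → Set Ω := fun i n =>
    {ω | N.M (tgt i) (n * S.len + S.warm + x) ω ≤ N.M (tgt i) (n * S.len + S.warm) ω}
  set blocked : Fin r → ℕ → Set Ω := fun i n =>
    N.longConnection (N.NID (tgt i)) (s _) (n * S.len) x
  -- Blocking is excluded in one more round than silence, since the final connections need free
  -- slots too.
  have hsub : {ω | (peri S V tgt).FailsAt N tgt ω} ⊆ ⋃ i : Fin r, (missed i ∪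
      (⋃ n ∈ Finset.range (r * S.rounds), silent i n)) ∪
      ⋃ n ∈ Finset.range (r * S.rounds + 1), blocked i n := by
    intro ω hω
    by_contra hcon
    simp only [Set.mem_iUnion, Set.mem_union, not_exists, not_or, Finset.mem_range] at hcon
    refine not_failsAt hN hF hxlen s (fun i t => hv i t ω)
      (fun i => (hcon i).2 (r * S.rounds) (by omega)) (fun i => ?_) hω
    refine found_eq hN hF hwarm hlen i (s _) (fun t => hv i t ω)
      (fun n hn => (hcon i).2 n (by omega))
      (fun n hn => not_le.1 ((hcon i).1.2 n hn)) ?_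
    have := (hcon i).1.1
    simp only [hmissed, Set.mem_ofPred_eq, not_forall, not_not] at this
    obtain ⟨m, hm, h⟩ := this
    exact ⟨m, hm, h⟩
  have hm1 : ∀ i, μ (missed i) ≤ ENNReal.ofReal (Real.exp (-(P.q * (S.rounds - 1 : ℕ)))) :=
    fun i => hO.measure_missed_le _ (hv i) (fun m => (i * S.rounds + m : ℕ) * S.len)
      (fun m => by
        have e : ((i * S.rounds + (m + 1) : ℕ) : ℝ≥0) * S.len =
          (i * S.rounds + m : ℕ) * S.len + S.len := by push_cast; ring
        simp only [e]
        gcongr) _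
  have hm2 : ∀ i n, μ (silent i n) ≤ ENNReal.ofReal (Real.exp (-(P.nu * x))) := fun i n =>
    ((hL.poisson _ ⟨i, rfl⟩).measure_no_arrival _ x).le
  have hm3 : ∀ i, ∀ n ∈ Finset.range (r * S.rounds + 1), μ (blocked i n) ≤ ENNReal.ofReal
      (Real.exp P.lam * Real.exp (-(P.lam * x)) * (r * S.rounds * S.len + 1)) := by
    intro i n hn
    refine (hL.measure_longConnection_le hN _ (s _) _ x).trans (ENNReal.ofReal_le_ofReal ?_)
    have : (n : ℝ) ≤ r * S.rounds := by
      exact_mod_cast Nat.lt_succ_iff.1 (Finset.mem_range.1 hn)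
    push_cast
    gcongr
  set e₁ := Real.exp (-(P.q * (S.rounds - 1 : ℕ)))
  set e₂ := Real.exp (-(P.nu * x))
  set e₃ := Real.exp P.lam * Real.exp (-(P.lam * x)) * (r * S.rounds * S.len + 1)
  have p₁ : 0 ≤ e₁ := Real.exp_nonneg _
  have p₂ : 0 ≤ e₂ := Real.exp_nonneg _
  have p₃ : 0 ≤ e₃ := by positivity
  clear_value e₁ e₂ e₃
  calc μ {ω | (peri S V tgt).FailsAt N tgt ω} ≤ _ := measure_mono hsub
    _ ≤ ∑ i : Fin r, μ ((missed i ∪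
      (⋃ n ∈ Finset.range (r * S.rounds), silent i n)) ∪
      ⋃ n ∈ Finset.range (r * S.rounds + 1), blocked i n) := measure_iUnion_fintype_le _ _
    _ ≤ ∑ i : Fin r, (ENNReal.ofReal e₁ + ∑ n ∈ Finset.range (r * S.rounds), ENNReal.ofReal e₂ +
          ∑ n ∈ Finset.range (r * S.rounds + 1), ENNReal.ofReal e₃) := by
        refine Finset.sum_le_sum fun i _ => ?_
        refine (measure_union_le _ _).trans (add_le_add ((measure_union_le _ _).trans
          (add_le_add (hm1 i) ?_)) ?_)
        · exact (measure_biUnion_finset_le _ _).trans (Finset.sum_le_sum fun n _ => hm2 i n)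
        · exact (measure_biUnion_finset_le _ _).trans (Finset.sum_le_sum fun n hn => hm3 i n hn)
    _ = _ := by
        rw [ENNReal.ofReal_mul (by positivity), ENNReal.ofReal_add (by positivity) (by positivity),
          ENNReal.ofReal_add (by positivity) (by positivity), ENNReal.ofReal_mul (by positivity),
          ENNReal.ofReal_mul (by positivity) (p := (r : ℝ) * S.rounds + 1)]
        have c1 : ENNReal.ofReal ((r : ℝ) * S.rounds) = ((r * S.rounds : ℕ) : ℝ≥0∞) := by
          rw [← Nat.cast_mul, ENNReal.ofReal_natCast]
        have c2 : ENNReal.ofReal ((r : ℝ) * S.rounds + 1) = ((r * S.rounds + 1 : ℕ) : ℝ≥0∞) := by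
          rw [← ENNReal.ofReal_natCast]; push_cast; rfl
        rw [c1, c2, ENNReal.ofReal_natCast]
        simp only [Finset.sum_const, Finset.card_range, Finset.card_univ, Fintype.card_fin,
          nsmul_eq_mul]

end Peri

theorem mainTheorem1 (P : NetParams) (ε₀ : ℝ) (hε₀ : ε₀ < 1) :
    ∃ C : ℝ, 0 < C ∧ ∀ (r : ℕ) (ε : ℝ), 0 < r → 0 < ε → ε ≤ ε₀ →
      ∃ S : PeriSchedule P,
        ∀ (V L : Type*) [Fintype V] (tgt : Fin r → L),
          ((peri S V tgt).horizon : ℝ) ≤ C * (r : ℝ) ^ 2 * ε⁻¹ * Real.log ε⁻¹ ^ 2 ∧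
          ∀ (Ω : Type*) [MeasurableSpace Ω] (μ : Measure Ω) [IsProbabilityMeasure μ]
            (N : NetworkData V L Ω),
            IsP2PNetwork P N →
            HasOracleLaw P N μ →
            IsLive P.lam P.nu N (Set.range tgt) μ →
            Function.Injective (fun i => N.NID (tgt i)) →
            (∀ i ω, N.NID (tgt i) ∈ N.nodes 0 ω) →
            (peri S V tgt).Follows N →
            μ {ω | (peri S V tgt).FailsAt N tgt ω} ≤ ENNReal.ofReal ε := by
  rcases le_or_gt ε₀ 0 with hneg | hpos
  · exact ⟨1, one_pos, fun r ε _ h1 h2 => absurd (h1.trans_le h2) (not_lt.2 hneg)⟩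
  -- With round length `2 * x + K`, there is room for the queries, the waiting time, a broadcast
  -- within `x` and its delivery; the `1` makes the inequality strict.
  set K : ℝ≥0 := ((P.k - 1 : ℕ) : ℝ≥0) * P.tau + (P.maxNodes + 1) * P.maxLatency + 1 with hK
  have hK1 : (1 : ℝ) ≤ K := by
    have : (1 : ℝ≥0) ≤ K := le_add_self
    exact_mod_cast this
  have hKR : (K : ℝ) =
      ((P.k - 1 : ℕ) : ℝ) * P.tau + (P.maxNodes + 1) * P.maxLatency + 1 := by
    simp only [hK, NNReal.coe_add, NNReal.coe_mul, NNReal.coe_natCast, NNReal.coe_one]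
  obtain ⟨A, B, hA, hB, hAB⟩ := exists_rounds_and_length P.lam P.nu P.q K P.lam_pos
    (by exact_mod_cast P.nu_pos) (by exact_mod_cast P.q_pos) hK1
  -- As `ε ≤ ε₀ < 1`, `Real.log ε⁻¹` stays above `δ > 0`, so the squared logarithm in the claim
  -- costs only a constant.
  set δ : ℝ := Real.log ε₀⁻¹ with hδ
  have hδ0 : 0 < δ := Real.log_pos ((one_lt_inv₀ hpos).2 hε₀)
  refine ⟨8 * A * (2 * B + K) / δ ^ 2, by positivity, fun r ε hr hε hεε => ?_⟩
  set X : ℝ := r / ε with hX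
  have hr1 : (1 : ℝ) ≤ r := by exact_mod_cast hr
  have hε1 : ε < 1 := hεε.trans_lt hε₀
  have hrX : (r : ℝ) ≤ X := by
    rw [hX, le_div_iff₀ hε]; nlinarith
  have hX1 : 1 ≤ X := hr1.trans hrX
  have hεX : ε * X = r := by rw [hX]; field_simp
  obtain ⟨R, x', hR, hx', hRA, hxB, hbound⟩ := hAB X hX1
  lift x' to ℝ≥0 using hx' with x hxx
  refine ⟨⟨R, 2 * x + K, x + P.maxNodes * P.maxLatency, ?_, ?_⟩, fun V L _ tgt => ⟨?_, ?_⟩⟩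
  · exact lt_of_lt_of_le (by exact_mod_cast zero_lt_one.trans_le hK1) le_add_self
  · rw [hK, add_assoc (_ * P.tau)]
    exact le_add_of_le_right le_self_add
  · have hl1 : δ ≤ Real.log ε⁻¹ :=
      Real.log_le_log (inv_pos.2 hpos) (inv_anti₀ hε hεε)
    have hlogX : 0 ≤ Real.log X := Real.log_nonneg hX1
    -- The time is in fact of order `r * (1 + log X) ^ 2`; this crude bound, with `X = r / ε`,
    -- already gives `r ^ 2 * ε⁻¹`.
    have hsq : (1 + Real.log X) ^ 2 ≤ 4 * X := by
      have h1 := Real.log_le_sub_one_of_pos (Real.sqrt_pos.2 (zero_lt_one.trans_le hX1))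
      rw [Real.log_sqrt (by linarith)] at h1
      have h2 : 1 + Real.log X ≤ 2 * √X := by linarith
      calc (1 + Real.log X) ^ 2 ≤ (2 * √X) ^ 2 := by gcongr
        _ = 4 * X := by rw [mul_pow, Real.sq_sqrt (by linarith)]; norm_num
    have hrR : (1 : ℝ) ≤ r * R := by exact_mod_cast Nat.mul_pos hr hR
    have hD : 2 * (x : ℝ) + K ≤ (2 * B + K) * (1 + Real.log X) := by
      have : (0 : ℝ) ≤ K * Real.log X := by positivity
      linarith
    have hδl : 1 ≤ Real.log ε⁻¹ ^ 2 / δ ^ 2 := by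
      rw [one_le_div (by positivity)]; gcongr
    simp only [peri]
    push_cast
    calc ((r : ℝ) * R + 1) * (2 * x + K) ≤ (2 * (r * R)) * (2 * x + K) := by gcongr; linarith
      _ ≤ (2 * (r * (A * (1 + Real.log X)))) * ((2 * B + K) * (1 + Real.log X)) := by gcongr
      _ = 2 * r * A * (2 * B + K) * (1 + Real.log X) ^ 2 := by ring
      _ ≤ 2 * r * A * (2 * B + K) * (4 * X) := by gcongr
      _ = 8 * A * (2 * B + K) * r ^ 2 * ε⁻¹ * 1 := by rw [hX]; ring
      _ ≤ 8 * A * (2 * B + K) * r ^ 2 * ε⁻¹ * (Real.log ε⁻¹ ^ 2 / δ ^ 2) := by gcongr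
      _ = _ := by ring
  · intro Ω _ μ _ N hN hO hL _ h0 hF
    refine (Peri.measure_failsAt_le (x := x) μ hN hO hL hF h0 rfl ?_).trans
      (ENNReal.ofReal_le_ofReal ?_)
    · rw [← NNReal.coe_lt_coe]
      push_cast
      rw [hKR]
      have : (0 : ℝ) ≤ ((P.k - 1 : ℕ) : ℝ) * P.tau := by positivity
      linarith
    · push_cast
      refine le_trans ?_ (mul_le_of_le_one_right hε.le hbound)
      calc _ ≤ (r : ℝ) * (Real.exp (-(P.q * (R - 1 : ℕ))) + X * R * Real.exp (-(P.nu * x)) +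
            (X * R + 1) * (Real.exp P.lam * Real.exp (-(P.lam * x)) *
              (X * R * (2 * x + K) + 1))) := by gcongr
        _ = ε * X * (Real.exp (-(P.q * (R - 1 : ℕ))) + X * R * Real.exp (-(P.nu * x)) +
            (X * R + 1) * (Real.exp P.lam * Real.exp (-(P.lam * x)) *
              (X * R * (2 * x + K) + 1))) := by rw [hεX]
        _ = _ := by ring
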